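/- **Markov selection theorem.** Let $X$ be a Polish space with Borel $\sigma$-algebra $\mathcal B_X$, and let $\Omega=C([0,\infty),X)$ be the space of continuous paths with the compact-open topology and its Borel $\sigma$-algebra $\mathcal F$. For $x\in X$ and $s\ge 0$ put $\Omega_x=\{w\in\Omega: w(0)=x\}$, $(\theta_s w)(t)=w(s+t)$, and $\mathcal F_s=\sigma(w\mapsto w(u): 0\le u\le s)$. Let $\mathscr P$ be the space of probability measures on $(\Omega,\mathcal F)$ with the weak topology (generated by $P\mapsto\int f\,dP$, $f\in C_b(\Omega)$). For $P\in\mathscr P$, let $P[\theta_s^{-1}(\cdot)\,|\,\mathcal F_s](w)$ denote the image under $\theta_s$ of the regular conditional probability distribution of $P$ given $\mathcal F_s$. A property holds $(P,\mathcal F_s)$-a.s. if it holds outside some $P$-null set that belongs to $\mathcal F_s$. A map $Q:\Omega\to\mathscr P$ is $\mathcal F_s$-measurable if $w\mapsto\int f\,dQ_w$ is $\mathcal F_s$-measurable for every $f\in C_b(\Omega)$. If $Q$ is $\mathcal F_s$-measurable and $Q_w(\Omega_{w(s)})=1$ for every $w$, then $P\otimes_s Q$ denotes the unique $R\in\mathscr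 P$ such that $R=P$ on $\mathcal F_s$ and $R[\theta_s^{-1}(\cdot)\,|\,\mathcal F_s](w)=Q_w$ for $R$-almost every $w$. Let $\mathscr C: X\to 2^{\mathscr P}$ satisfy * (C1) $\mathscr C(x)$ is a nonempty compact convex subset of $\mathscr P$ for every $x\in X$; * (C2) $\{x\in X:\mathscr C(x)\cap K\ne\emptyset\}\in\mathcal B_X$ for every closed $K\subset\mathscr P$; * (C3) $P(\Omega_x)=1$ for every $x\in X$ and every $P\in\mathscr C(x)$; * (MP1) for all $x\in X$, $P\in\mathscr C(x)$ and $s\ge 0$, $\;P[\theta_s^{-1}(\cdot)\,|\,\mathcal F_s](w)\in\mathscr C(w(s))$, $(P,\mathcal F_s)$-a.s.; * (MP2) for all $s\ge 0$, every $\mathcal F_s$-measurable $Q:\Omega\to\mathscr P$ with $Q_w\in\mathscr C(w(s))$ for all $w\in\Omega$, and all $x\in X$ and $P\in\mathscr C(x)$, $\;P\otimes_s Q\in\mathscr C(x)$. Then there is a Borel measurable map $X\to\mathscr P$, $x\mapsto P_x$, with $P_x\in\mathscr C(x)$ for every $x\in X$, such that for all $x\in X$ and $s\ge 0$ $$P_x[\theta_s^{-1}(\cdot)\,|\,\mathcal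 F_s](w)=P_{w(s)}\qquad (P_x,\mathcal F_s)\text{-a.s.}$$ -/

import Mathlib

open MeasureTheory ProbabilityTheory Set Topology
open scoped NNReal ENNReal BoundedContinuousFunction

namespace MarkovSelection

/-- The space of continuous one-sided infinite paths in `X`. Mathlib's topology on it is the
compact-open topology. -/
abbrev PathSpace (X : Type*) [TopologicalSpace X] : Type _ := C(ℝ≥0, X)

section Paths

set_option linter.unusedSectionVars false

variable {X : Type*} [TopologicalSpace X]

/-- The Borel sigma-algebra on the path space. -/
instance instMeasurableSpacePath : MeasurableSpace (PathSpace X) := borel _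

instance instBorelSpacePath : BorelSpace (PathSpace X) := ⟨rfl⟩

instance instPolishSpacePath [PolishSpace X] : PolishSpace (PathSpace X) := by
  let := TopologicalSpace.upgradeIsCompletelyMetrizable X
  infer_instance

/-- The set of paths that start at `x`. -/
def pathsFrom (x : X) : Set (PathSpace X) := {w | w 0 = x}

/-- The shift of paths, `(shift s w) t = w (s + t)`. -/
def shift (s : ℝ≥0) (w : PathSpace X) : PathSpace X :=
  w.comp ⟨fun t => s + t, by fun_prop⟩

@[simp] theorem shift_apply (s t : ℝ≥0) (w : PathSpace X) : shift s w t = w (s + t) := rfl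

theorem continuous_shift (s : ℝ≥0) : Continuous (shift s : PathSpace X → PathSpace X) :=
  ContinuousMap.continuous_precomp _

theorem measurable_shift (s : ℝ≥0) : Measurable (shift s : PathSpace X → PathSpace X) :=
  (continuous_shift s).measurable

variable [MeasurableSpace X]

theorem measurable_coord [BorelSpace X] (t : ℝ≥0) :
    Measurable (fun w : PathSpace X => w t) :=
  (ContinuousEvalConst.continuous_eval_const t).measurable

/-- The natural filtration of the path space: `pathFiltration X s` is generated by the
coordinates `w ↦ w u` with `u ≤ s`. -/
def pathFiltration (X : Type*) [TopologicalSpace X] [MeasurableSpace X] [BorelSpace X] :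
    Filtration ℝ≥0 (instMeasurableSpacePath : MeasurableSpace (PathSpace X)) where
  seq s := ⨆ u : ℝ≥0, ⨆ _ : u ≤ s,
    MeasurableSpace.comap (fun w : PathSpace X => w u) inferInstance
  mono' _ _ hst := iSup_mono fun _ => iSup_le fun hu => le_iSup_of_le (hu.trans hst) le_rfl
  le' _ := iSup_le fun u => iSup_le fun _ => (measurable_coord u).comap_le

variable [BorelSpace X]

/-- `p` holds `(P, 𝓕_s)`-almost surely: outside a `P`-null set that belongs to `𝓕_s`. -/
def AlmostSurelyIn (P : ProbabilityMeasure (PathSpace X)) (s : ℝ≥0)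
    (p : PathSpace X → Prop) : Prop :=
  ∃ N : Set (PathSpace X), MeasurableSet[pathFiltration X s] N ∧
    (P : Measure (PathSpace X)) N = 0 ∧ ∀ w, w ∉ N → p w

/-- A family `Q` of probability measures on paths is `𝓕_s`-measurable if `w ↦ ∫ f d(Q w)` is,
for every bounded continuous function `f` on the path space. -/
def IsMeasurableFamily (s : ℝ≥0) (Q : PathSpace X → ProbabilityMeasure (PathSpace X)) : Prop :=
  ∀ f : PathSpace X →ᵇ ℝ,
    Measurable[pathFiltration X s] fun w => ∫ v, f v ∂(Q w : Measure (PathSpace X))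

variable [PolishSpace X]


/-- The conditional law `P[θ_s⁻¹(·) | 𝓕_s](w)` of the shifted path: the image under the shift of
the regular conditional probability distribution of `P` given `𝓕_s`. -/
noncomputable def condLawShift (P : ProbabilityMeasure (PathSpace X)) (s : ℝ≥0)
    (w : PathSpace X) : ProbabilityMeasure (PathSpace X) :=
  ⟨(condExpKernel (P : Measure (PathSpace X)) (pathFiltration X s) w).map (shift s),
    Measure.isProbabilityMeasure_map (measurable_shift s).aemeasurable⟩

/-- The properties that characterize the measure `P ⊗_s Q`: it agrees with `P` on `𝓕_s`, and
under it the conditional law of the shifted path given `𝓕_s` is almost surely `Q`. -/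
structure IsConcat (P : ProbabilityMeasure (PathSpace X)) (s : ℝ≥0)
    (Q : PathSpace X → ProbabilityMeasure (PathSpace X))
    (R : ProbabilityMeasure (PathSpace X)) : Prop where
  agree : ∀ A : Set (PathSpace X), MeasurableSet[pathFiltration X s] A →
    (R : Measure (PathSpace X)) A = (P : Measure (PathSpace X)) A
  condLaw : ∀ᵐ w ∂(R : Measure (PathSpace X)), condLawShift R s w = Q w

/-! Existence and uniqueness of `P ⊗_s Q`. -/

theorem IsMeasurableFamily.measurable_apply {s : ℝ≥0}
    {Q : PathSpace X → ProbabilityMeasure (PathSpace X)} (hQ : IsMeasurableFamily s Q) :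
    Measurable[pathFiltration X s] fun w => (Q w : Measure (PathSpace X)) := by
  let := TopologicalSpace.upgradeIsCompletelyMetrizable (PathSpace X)
  refine Measurable.measure_of_isPiSystem_of_isProbabilityMeasure
    (mα := pathFiltration X s) (S := {A | IsClosed A}) ?_ isPiSystem_isClosed ?_
  · rw [← borel_eq_generateFrom_isClosed]; rfl
  · intro F (hF : IsClosed F)
    have hlim := fun w => tendsto_lintegral_thickenedIndicator_of_isClosed
      (Q w : Measure (PathSpace X)) hF (fun n : ℕ => Nat.one_div_pos_of_nat (α := ℝ) (n := n))
      tendsto_one_div_add_atTop_nhds_zero_nat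
    refine @measurable_of_tendsto_metrizable _ _ (pathFiltration X s) _ _ _ _ _ _ (fun n => ?_)
      (tendsto_pi_nhds.2 hlim)
    have h_pos : (0 : ℝ) < 1 / ((n : ℝ) + 1) := Nat.one_div_pos_of_nat
    have key : ∀ w, ∫⁻ v, (thickenedIndicator h_pos F v : ℝ≥0∞) ∂(Q w : Measure (PathSpace X))
        = ENNReal.ofReal (∫ v, ((thickenedIndicator h_pos F v : ℝ≥0) : ℝ)
            ∂(Q w : Measure (PathSpace X))) := fun w =>
      lintegral_coe_eq_integral _ (integrable_thickenedIndicator F h_pos)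
    simp_rw [key]
    exact ENNReal.measurable_ofReal.comp
      (hQ (BoundedContinuousFunction.comp _ NNReal.isometry_coe.lipschitz
        (thickenedIndicator h_pos F)))

/-- The Borel sigma-algebra on paths is generated by countably many coordinates. -/
theorem measurableSpace_path_eq :
    (instMeasurableSpacePath : MeasurableSpace (PathSpace X)) =
      MeasurableSpace.comap (fun w n => w (TopologicalSpace.denseSeq ℝ≥0 n)) MeasurableSpace.pi := by
  let φ : PathSpace X → ℕ → X := fun w n => w (TopologicalSpace.denseSeq ℝ≥0 n)
  have hφ : Measurable φ := measurable_pi_lambda _ fun n => measurable_coord _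
  have inj : Function.Injective φ := fun w v hwv => by
    apply DFunLike.coe_injective
    refine (TopologicalSpace.denseRange_denseSeq ℝ≥0).equalizer w.continuous v.continuous ?_
    exact hwv
  exact (hφ.measurableEmbedding inj).comap_eq.symm

/-- The pair (path up to time `s`, path after time `s`) generates the Borel sigma-algebra. -/
theorem measurableSpace_path_le_comap (s : ℝ≥0) :
    (instMeasurableSpacePath : MeasurableSpace (PathSpace X)) ≤
      MeasurableSpace.comap (fun w => (w, shift s w))
        ((pathFiltration X s : MeasurableSpace (PathSpace X)).prod instMeasurableSpacePath) := by
  nth_rewrite 1 [measurableSpace_path_eq]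
  refine Measurable.comap_le ?_
  refine @measurable_pi_lambda _ _ _ (_) _ _ fun n => ?_
  change @Measurable _ _ (_) _ fun w : PathSpace X => w (TopologicalSpace.denseSeq ℝ≥0 n)
  set t := TopologicalSpace.denseSeq ℝ≥0 n
  have hpair := comap_measurable (m := (pathFiltration X s : MeasurableSpace (PathSpace X)).prod
    instMeasurableSpacePath) (fun w : PathSpace X => (w, shift s w))
  rcases le_total t s with hts | hts
  · have h1 : Measurable[pathFiltration X s] fun w : PathSpace X => w t := by
      refine Measurable.of_comap_le ?_
      exact le_iSup_of_le t (le_iSup_of_le hts le_rfl)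
    exact h1.comp ((@measurable_fst _ _ (pathFiltration X s) _).comp hpair)
  · have h2 := (measurable_coord (X := X) (t - s)).comp
      ((@measurable_snd _ _ (pathFiltration X s) _).comp hpair)
    convert h2 using 1
    ext w
    simp [add_tsub_cancel_of_le hts]

/-- Membership in a set of `𝓕_s` depends only on the path up to time `s`. -/
theorem mem_iff_of_eqOn {s : ℝ≥0} {A : Set (PathSpace X)}
    (hA : MeasurableSet[pathFiltration X s] A) {w v : PathSpace X}
    (h : ∀ u ≤ s, w u = v u) : w ∈ A ↔ v ∈ A := by
  have hle : pathFiltration X s ≤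
      MeasurableSpace.comap (fun (w : PathSpace X) (u : Iic s) => w u) ⊤ := by
    refine iSup_le fun u => iSup_le fun hu => ?_
    rintro _ ⟨B, -, rfl⟩
    exact ⟨{g | g ⟨u, hu⟩ ∈ B}, trivial, rfl⟩
  obtain ⟨T, -, rfl⟩ := hle _ hA
  have : (fun u : Iic s => w u) = fun u : Iic s => v u := funext fun u => h u u.2
  simp only [mem_preimage, this]


/-- The path that follows `p.1` up to time `s` and `p.2` afterwards, if `p.1 s = p.2 0`;
otherwise just `p.1`. -/
noncomputable def spliceFun (s : ℝ≥0) (p : PathSpace X × PathSpace X) : PathSpace X :=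
  open Classical in
  if h : p.1 s = p.2 0 then
    ⟨fun t => if t ≤ s then p.1 t else p.2 (t - s), by
      refine Continuous.if_le (by fun_prop) (by fun_prop) continuous_id continuous_const ?_
      rintro t rfl
      simpa using h⟩
  else p.1

theorem spliceFun_of_le {s t : ℝ≥0} (p : PathSpace X × PathSpace X) (ht : t ≤ s) :
    spliceFun s p t = p.1 t := by
  unfold spliceFun
  split_ifs with h
  · simp [ht]
  · rfl

theorem shift_spliceFun {s : ℝ≥0} {p : PathSpace X × PathSpace X} (h : p.1 s = p.2 0) :
    shift s (spliceFun s p) = p.2 := by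
  ext t
  rw [shift_apply, spliceFun, dif_pos h]
  simp only [ContinuousMap.coe_mk]
  split_ifs with ht
  · obtain rfl : t = 0 := by simpa using ht
    simpa using h
  · simp

theorem measurable_spliceFun (s : ℝ≥0) :
    Measurable (spliceFun s : PathSpace X × PathSpace X → PathSpace X) := by
  let D : Set (PathSpace X × PathSpace X) := {p | p.1 s = p.2 0}
  have hD : IsClosed D := isClosed_eq (by fun_prop) (by fun_prop)
  refine measurable_of_restrict_of_restrict_compl hD.measurableSet ?_ ?_
  · refine Continuous.measurable ?_
    refine ContinuousMap.continuous_of_continuous_uncurry _ ?_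
    have : Function.uncurry (fun (p : D) (t : ℝ≥0) => (D.domRestrict (spliceFun s) p) t) =
        fun q : D × ℝ≥0 => if q.2 ≤ s then q.1.1.1 q.2 else q.1.1.2 (q.2 - s) := by
      ext ⟨⟨p, hp⟩, t⟩
      simp only [Function.uncurry, domRestrict_apply]
      have hp' : p.1 s = p.2 0 := hp
      simp [spliceFun, hp']
    rw [this]
    refine Continuous.if_le (by fun_prop) (by fun_prop) (by fun_prop) continuous_const ?_
    rintro ⟨⟨p, hp⟩, t⟩ (rfl : t = s)
    have hp' : p.1 t = p.2 0 := hp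
    simpa using hp'
  · have : Dᶜ.domRestrict (spliceFun s) = fun p : (Dᶜ : Set _) => (p : PathSpace X × PathSpace X).1 := by
      ext1 ⟨p, hp⟩
      have hp' : ¬ p.1 s = p.2 0 := hp
      simp [spliceFun, hp']
    rw [this]
    fun_prop

/-- The kernel of a measurable family. -/
def IsMeasurableFamily.kernel {s : ℝ≥0} {Q : PathSpace X → ProbabilityMeasure (PathSpace X)}
    (hQ : IsMeasurableFamily s Q) :
    @Kernel (PathSpace X) (PathSpace X) (pathFiltration X s) instMeasurableSpacePath :=
  @Kernel.mk _ _ (pathFiltration X s) _ (fun w => (Q w : Measure (PathSpace X)))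
    hQ.measurable_apply

theorem IsMeasurableFamily.isMarkovKernel {s : ℝ≥0}
    {Q : PathSpace X → ProbabilityMeasure (PathSpace X)} (hQ : IsMeasurableFamily s Q) :
    @IsMarkovKernel _ _ (pathFiltration X s) _ hQ.kernel :=
  @IsMarkovKernel.mk _ _ (pathFiltration X s) _ _ fun w => (Q w).2

theorem setLIntegral_trim_path {s : ℝ≥0} (R : Measure (PathSpace X))
    {A : Set (PathSpace X)} (hA : MeasurableSet[pathFiltration X s] A)
    {f : PathSpace X → ℝ≥0∞} (hf : Measurable[pathFiltration X s] f) :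
    ∫⁻ w in A, f w ∂(R.trim ((pathFiltration X).le s)) = ∫⁻ w in A, f w ∂ R := by
  rw [restrict_trim ((pathFiltration X).le s) R hA, lintegral_trim _ hf]

theorem condLaw_iff {s : ℝ≥0} {Q : PathSpace X → ProbabilityMeasure (PathSpace X)}
    (hQ : IsMeasurableFamily s Q) (R : ProbabilityMeasure (PathSpace X)) :
    (∀ᵐ w ∂(R : Measure (PathSpace X)), condLawShift R s w = Q w) ↔
      ∀ A B : Set (PathSpace X), MeasurableSet[pathFiltration X s] A → MeasurableSet B →
        (R : Measure (PathSpace X)) (A ∩ shift s ⁻¹' B) =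
          ∫⁻ w in A, (Q w : Measure (PathSpace X)) B ∂(R : Measure (PathSpace X)) := by
  have hm := (pathFiltration X).le s
  set κ := (condExpKernel (R : Measure (PathSpace X)) (pathFiltration X s)) with hκ
  have hθ := measurable_shift (X := X) s
  have base : ∀ A B : Set (PathSpace X), MeasurableSet[pathFiltration X s] A → MeasurableSet B →
      (R : Measure (PathSpace X)) (A ∩ shift s ⁻¹' B) =
        ∫⁻ w in A, κ w (shift s ⁻¹' B) ∂(R : Measure (PathSpace X)) := by
    intro A B hA hB
    have h := DFunLike.congr_fun
      (compProd_trim_condExpKernel (μ := (R : Measure (PathSpace X))) hm) (A ×ˢ (shift s ⁻¹' B))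
    rw [@Measure.compProd_apply_prod _ _ (pathFiltration X s) _ _ _ _ _ _ _ hA (hθ hB),
      setLIntegral_trim_path _ hA (Kernel.measurable_coe _ (hθ hB)),
      @Measure.map_apply _ _ _ ((pathFiltration X s : MeasurableSpace (PathSpace X)).prod
        instMeasurableSpacePath) _ _ ?_ _ ?_] at h
    · exact h.symm
    · exact @Measurable.prodMk _ _ _ _ (pathFiltration X s) _ _ _ (measurable_id'' hm)
        measurable_id
    · exact @MeasurableSet.prod _ _ (pathFiltration X s) _ _ _ hA (hθ hB)
  constructor
  · intro h A B hA hB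
    rw [base A B hA hB]
    refine lintegral_congr_ae (ae_restrict_of_ae ?_)
    filter_upwards [h] with w hw
    rw [← hw]
    simp only [condLawShift, ProbabilityMeasure.coe_mk]
    rw [Measure.map_apply hθ hB]
  · intro h
    have hMQ := hQ.isMarkovKernel
    have hMκ : @IsMarkovKernel _ _ (pathFiltration X s) _ (κ.map (shift s)) :=
      Kernel.IsMarkovKernel.map κ hθ
    have key : (κ.map (shift s)) =ᵐ[(R : Measure (PathSpace X)).trim hm] hQ.kernel := by
      refine @Kernel.ae_eq_of_compProd_eq _ _ (pathFiltration X s) _ _ _ _ _ _ _ _ ?_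
      refine @Measure.ext_prod _ _ (pathFiltration X s) _ _ _ _ ?_
      intro A B hA hB
      rw [@Measure.compProd_apply_prod _ _ (pathFiltration X s) _ _ _ _ _ _ _ hA hB,
        @Measure.compProd_apply_prod _ _ (pathFiltration X s) _ _ _ _ _ _ _ hA hB,
        setLIntegral_trim_path _ hA (Kernel.measurable_coe _ hB),
        setLIntegral_trim_path _ hA (Kernel.measurable_coe _ hB)]
      refine Eq.trans ?_ (h A B hA hB)
      rw [base A B hA hB]
      refine lintegral_congr fun w => ?_
      rw [Kernel.map_apply' _ hθ _ hB]
    filter_upwards [ae_eq_of_ae_eq_trim key] with w hw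
    apply Subtype.ext
    rw [Kernel.map_apply _ hθ] at hw
    exact hw

theorem isConcat_iff {P : ProbabilityMeasure (PathSpace X)} {s : ℝ≥0}
    {Q : PathSpace X → ProbabilityMeasure (PathSpace X)} (hQ : IsMeasurableFamily s Q)
    (R : ProbabilityMeasure (PathSpace X)) :
    IsConcat P s Q R ↔
      ∀ A B : Set (PathSpace X), MeasurableSet[pathFiltration X s] A → MeasurableSet B →
        (R : Measure (PathSpace X)) (A ∩ shift s ⁻¹' B) =
          ∫⁻ w in A, (Q w : Measure (PathSpace X)) B ∂(P : Measure (PathSpace X)) := by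
  have hm := (pathFiltration X).le s
  have swap : (∀ A : Set (PathSpace X), MeasurableSet[pathFiltration X s] A →
      (R : Measure (PathSpace X)) A = (P : Measure (PathSpace X)) A) →
      ∀ A B : Set (PathSpace X), MeasurableSet[pathFiltration X s] A → MeasurableSet B →
        ∫⁻ w in A, (Q w : Measure (PathSpace X)) B ∂(R : Measure (PathSpace X)) =
          ∫⁻ w in A, (Q w : Measure (PathSpace X)) B ∂(P : Measure (PathSpace X)) := by
    intro h A B hA hB
    have ht : (R : Measure (PathSpace X)).trim hm = (P : Measure (PathSpace X)).trim hm := by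
      refine @Measure.ext _ (pathFiltration X s) _ _ fun C hC => ?_
      rw [trim_measurableSet_eq hm hC, trim_measurableSet_eq hm hC, h C hC]
    have hf := @Kernel.measurable_coe _ _ (pathFiltration X s) _ hQ.kernel _ hB
    have h1 := setLIntegral_trim_path (R : Measure (PathSpace X)) hA hf
    have h2 := setLIntegral_trim_path (P : Measure (PathSpace X)) hA hf
    rw [ht] at h1
    exact h1.symm.trans h2
  constructor
  · rintro ⟨h1, h2⟩ A B hA hB
    rw [(condLaw_iff hQ R).1 h2 A B hA hB, swap h1 A B hA hB]
  · intro h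
    have h1 : ∀ A : Set (PathSpace X), MeasurableSet[pathFiltration X s] A →
        (R : Measure (PathSpace X)) A = (P : Measure (PathSpace X)) A := by
      intro A hA
      simpa using h A univ hA MeasurableSet.univ
    refine ⟨h1, (condLaw_iff hQ R).2 fun A B hA hB => ?_⟩
    rw [h A B hA hB, swap h1 A B hA hB]

/-- If `Q w` is carried by the paths that start at `w s`, there is exactly one measure with the
properties that characterize `P ⊗_s Q`. -/
theorem existsUnique_isConcat (P : ProbabilityMeasure (PathSpace X)) (s : ℝ≥0)
    (Q : PathSpace X → ProbabilityMeasure (PathSpace X)) (hQ : IsMeasurableFamily s Q)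
    (hsupp : ∀ w, (Q w : Measure (PathSpace X)) (pathsFrom (w s)) = 1) :
    ∃! R : ProbabilityMeasure (PathSpace X), IsConcat P s Q R := by
  have hm := (pathFiltration X).le s
  have hθ := measurable_shift (X := X) s
  have hS := measurable_spliceFun (X := X) s
  simp_rw [isConcat_iff hQ]
  refine existsUnique_of_exists_of_unique ?_ ?_
  · let κ : Kernel (PathSpace X) (PathSpace X) :=
      ⟨fun w => (Q w : Measure (PathSpace X)), hQ.measurable_apply.mono hm le_rfl⟩
    have : IsMarkovKernel κ := ⟨fun w => (Q w).2⟩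
    refine ⟨⟨((P : Measure (PathSpace X)) ⊗ₘ κ).map (spliceFun s),
      Measure.isProbabilityMeasure_map hS.aemeasurable⟩, fun A B hA hB => ?_⟩
    have hAB : MeasurableSet (A ∩ shift s ⁻¹' B) := (hm _ hA).inter (hθ hB)
    rw [ProbabilityMeasure.coe_mk, Measure.map_apply hS hAB, Measure.compProd_apply (hS hAB),
      ← lintegral_indicator (hm _ hA)]
    refine lintegral_congr fun w => ?_
    have hae : ∀ᵐ v ∂(Q w : Measure (PathSpace X)), v 0 = w s := by
      have hmeas : MeasurableSet (pathsFrom (w s)) :=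
        measurable_coord (X := X) 0 (measurableSet_singleton (w s))
      exact (prob_compl_eq_zero_iff hmeas).2 (hsupp w)
    have hset : (κ w) (Prod.mk w ⁻¹' (spliceFun s ⁻¹' (A ∩ shift s ⁻¹' B))) =
        (κ w) {v | w ∈ A ∧ v ∈ B} := by
      refine measure_congr ?_
      filter_upwards [hae] with v hv
      have e1 : shift s (spliceFun s (w, v)) = v := shift_spliceFun (p := (w, v)) hv.symm
      have e2 : spliceFun s (w, v) ∈ A ↔ w ∈ A :=
        mem_iff_of_eqOn hA fun u hu => spliceFun_of_le (w, v) hu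
      apply propext
      change (spliceFun s (w, v) ∈ A ∧ shift s (spliceFun s (w, v)) ∈ B) ↔ (w ∈ A ∧ v ∈ B)
      rw [e1, e2]
    rw [hset]
    by_cases hw : w ∈ A
    · simp [hw, κ]
    · simp [hw]
  · intro R R' hR hR'
    apply Subtype.ext
    have hpair : @Measurable _ _ _ ((pathFiltration X s : MeasurableSpace (PathSpace X)).prod
        instMeasurableSpacePath) fun w : PathSpace X => (w, shift s w) :=
      @Measurable.prodMk _ _ _ _ (pathFiltration X s) _ _ _ (measurable_id'' hm) hθ
    have hmap : @Measure.map _ _ _ ((pathFiltration X s : MeasurableSpace (PathSpace X)).prod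
        instMeasurableSpacePath) (fun w : PathSpace X => (w, shift s w)) R =
        @Measure.map _ _ _ ((pathFiltration X s : MeasurableSpace (PathSpace X)).prod
        instMeasurableSpacePath) (fun w : PathSpace X => (w, shift s w)) R' := by
      have := @Measure.isFiniteMeasure_map _ _ ((pathFiltration X s :
        MeasurableSpace (PathSpace X)).prod instMeasurableSpacePath) _
        (R : Measure (PathSpace X)) _ (fun w => (w, shift s w))
      refine @Measure.ext_prod _ _ (pathFiltration X s) _ _ _ _ ?_
      intro A B hA hB
      have hAB := @MeasurableSet.prod _ _ (pathFiltration X s) _ _ _ hA hB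
      rw [@Measure.map_apply _ _ _ (_) _ _ hpair _ hAB,
        @Measure.map_apply _ _ _ (_) _ _ hpair _ hAB]
      exact (hR A B hA hB).trans (hR' A B hA hB).symm
    ext C hC
    obtain ⟨T, hT, rfl⟩ := measurableSpace_path_le_comap (X := X) s C hC
    have := DFunLike.congr_fun hmap T
    rwa [@Measure.map_apply _ _ _ (_) _ _ hpair _ hT,
      @Measure.map_apply _ _ _ (_) _ _ hpair _ hT] at this

/-- The measure `P ⊗_s Q`: the unique probability measure that agrees with `P` on `𝓕_s` and
under which the conditional law of the shifted path given `𝓕_s` is almost surely `Q`. -/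
noncomputable def concat (P : ProbabilityMeasure (PathSpace X)) (s : ℝ≥0)
    (Q : PathSpace X → ProbabilityMeasure (PathSpace X)) (hQ : IsMeasurableFamily s Q)
    (hsupp : ∀ w, (Q w : Measure (PathSpace X)) (pathsFrom (w s)) = 1) :
    ProbabilityMeasure (PathSpace X) :=
  (existsUnique_isConcat P s Q hQ hsupp).choose

theorem isConcat_concat (P : ProbabilityMeasure (PathSpace X)) (s : ℝ≥0)
    (Q : PathSpace X → ProbabilityMeasure (PathSpace X)) (hQ : IsMeasurableFamily s Q)
    (hsupp : ∀ w, (Q w : Measure (PathSpace X)) (pathsFrom (w s)) = 1) :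
    IsConcat P s Q (concat P s Q hQ hsupp) :=
  (existsUnique_isConcat P s Q hQ hsupp).choose_spec.1

end Paths

end MarkovSelection

/-!
The Markov selection is obtained by maximizing countably many functionals one after the other.

A functional of the form `G w = ∫ e⁻ᵗ h (t, w t) dt`, with `h (s + t, x) = c s * h (t, x)`, splits
at each time `s` into a functional of the path up to time `s` and a positive multiple of `G` applied
to the path after time `s` (`IsDiscounted`). Stability under concatenation therefore gives a dynamic
programming principle: a law that maximizes the expectation of `G` over `C x` has conditional laws
given `𝓕_s` that almost surely maximize it over `C (w s)`, and concatenating maximizers gives a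
maximizer. So measurability, compactness and both kinds of stability pass from `C` to the sets of
maximizers (`IsMarkovFamily.argmaxOn`), and by compactness to decreasing intersections
(`IsMarkovFamily.iInter`).

The concatenation with maximizers needs a measurable selection of them. It is itself obtained by
successive maximization, of countably many continuous functions that separate the probability
measures (`IsMeasurableCompactValued.exists_measurable_selection`).

The functionals are chosen with `h (t, x) = e⁻ⁿᵗ f x`, where `f` runs over a countable
multiplicative family that separates the points of `X`. Their expectations determine the joint law
of `(T, w T)` for an independent exponential time `T`, by Stone–Weierstrass, and hence the law of
`w t` for each `t`, by continuity (`exists_isDiscounted_determining`). After all these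
maximizations, the laws that are left in the set of `x` share their one-dimensional marginals. Since
their conditional laws are left in the sets of the points `w s`, an induction on the number of times
shows that they share all finite-dimensional distributions (`IsMarkovFamily.eq_of_marginals`). So
one law `P x` is left, and stability under conditioning becomes the Markov property.
-/

namespace MarkovSelection

/-! ### Compact-valued multifunctions and successive maximization -/

section Multifunction

variable {X Y : Type*}

/-- A multifunction with nonempty compact values that is measurable in the sense that the points
whose value meets a given closed set form a measurable set. -/
structure IsMeasurableCompactValued [MeasurableSpace X] [TopologicalSpace Y] (C : X → Set Y) :
    Prop where
  nonempty : ∀ x, (C x).Nonempty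
  isCompact : ∀ x, IsCompact (C x)
  measurableSet : ∀ K, IsClosed K → MeasurableSet {x | (C x ∩ K).Nonempty}

/-- The points of `C x` at which `F` is maximal on `C x`. -/
def argmaxOn (F : Y → ℝ≥0∞) (C : X → Set Y) (x : X) : Set Y :=
  {p | p ∈ C x ∧ ∀ q ∈ C x, F q ≤ F p}

theorem argmaxOn_subset (F : Y → ℝ≥0∞) (C : X → Set Y) (x : X) : argmaxOn F C x ⊆ C x :=
  fun _ hp => hp.1

theorem eq_of_mem_argmaxOn {F : Y → ℝ≥0∞} {C : X → Set Y} {x : X} {p q : Y}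
    (hp : p ∈ argmaxOn F C x) (hq : q ∈ argmaxOn F C x) : F p = F q :=
  le_antisymm (hq.2 p hp.1) (hp.2 q hq.1)

/-- The multifunctions obtained from `C` by maximizing `F 0`, `F 1`, … one after the other, each
over the set of maximizers left by its predecessors. -/
def iterArgmax (F : ℕ → Y → ℝ≥0∞) (C : X → Set Y) : ℕ → X → Set Y
  | 0 => C
  | n + 1 => argmaxOn (F n) (iterArgmax F C n)

theorem eq_of_mem_iInter_iterArgmax {F : ℕ → Y → ℝ≥0∞} {C : X → Set Y} {x : X} {p q : Y}
    (hp : p ∈ ⋂ n, iterArgmax F C n x) (hq : q ∈ ⋂ n, iterArgmax F C n x) (n : ℕ) :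
    F n p = F n q :=
  eq_of_mem_argmaxOn (mem_iInter.1 hp (n + 1)) (mem_iInter.1 hq (n + 1))

variable [MeasurableSpace X] [TopologicalSpace Y]

/-- Maximizing a continuous function over the values preserves measurability: the maximizers over
`C x` meet `K` if and only if `C x ∩ K` reaches every rational level that `C x` reaches. -/
theorem IsMeasurableCompactValued.argmaxOn [T2Space Y] {C : X → Set Y}
    (hC : IsMeasurableCompactValued C) {F : Y → ℝ≥0∞} (hF : Continuous F) :
    IsMeasurableCompactValued (argmaxOn F C) where
  nonempty x := by
    obtain ⟨p, hp, hmax⟩ := (hC.isCompact x).exists_isMaxOn (hC.nonempty x) hF.continuousOn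
    exact ⟨p, hp, fun q hq => hmax hq⟩
  isCompact x := by
    refine (hC.isCompact x).of_isClosed_subset ?_ (argmaxOn_subset F C x)
    have : MarkovSelection.argmaxOn F C x = C x ∩ ⋂ q ∈ C x, {p | F q ≤ F p} := by
      ext p; simp [MarkovSelection.argmaxOn]
    rw [this]
    exact (hC.isCompact x).isClosed.inter
      (isClosed_biInter fun q _ => isClosed_le continuous_const hF)
  measurableSet K hK := by
    obtain ⟨D, hDc, hD⟩ := TopologicalSpace.exists_countable_dense ℝ≥0∞
    have hlev : ∀ a, IsClosed {p | a ≤ F p} := fun a => isClosed_le continuous_const hF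
    have key : {x | (MarkovSelection.argmaxOn F C x ∩ K).Nonempty} =
        {x | (C x ∩ K).Nonempty} ∩ ⋂ a ∈ D, ({x | (C x ∩ {p | a ≤ F p}).Nonempty}ᶜ ∪
          {x | (C x ∩ (K ∩ {p | a ≤ F p})).Nonempty}) := by
      ext x
      simp only [mem_ofPred_eq, mem_inter_iff, mem_iInter, mem_union, mem_compl_iff]
      constructor
      · rintro ⟨p, ⟨hp, hmax⟩, hpK⟩
        refine ⟨⟨p, hp, hpK⟩, fun a _ => ?_⟩
        by_cases h : (C x ∩ {p | a ≤ F p}).Nonempty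
        · obtain ⟨q, hq, haq⟩ := h
          exact Or.inr ⟨p, hp, hpK, le_trans haq (hmax q hq)⟩
        · exact Or.inl h
      · rintro ⟨hne, hall⟩
        obtain ⟨p, hp, hmax⟩ :=
          ((hC.isCompact x).inter_right hK).exists_isMaxOn hne hF.continuousOn
        refine ⟨p, ⟨hp.1, fun q hq => ?_⟩, hp.2⟩
        by_contra! hlt
        obtain ⟨a, haD, hpa, haq⟩ := hD.exists_between hlt
        rcases hall a haD with h | ⟨r, hr, hrK, har⟩
        · exact h ⟨q, hq, haq.le⟩
        · exact absurd (hpa.trans_le har) (not_lt.2 (hmax ⟨hr, hrK⟩))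
    rw [key]
    refine (hC.measurableSet K hK).inter (MeasurableSet.biInter hDc fun a _ => ?_)
    exact (hC.measurableSet _ (hlev a)).compl.union (hC.measurableSet _ (hK.inter (hlev a)))

/-- The intersection of a decreasing sequence of measurable compact-valued multifunctions is
again one, by compactness. -/
theorem IsMeasurableCompactValued.iInter [T2Space Y] {C : ℕ → X → Set Y}
    (hC : ∀ n, IsMeasurableCompactValued (C n)) (hanti : ∀ n x, C (n + 1) x ⊆ C n x) :
    IsMeasurableCompactValued fun x => ⋂ n, C n x where
  nonempty x := IsCompact.nonempty_iInter_of_sequence_nonempty_isCompact_isClosed _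
    (fun n => hanti n x) (fun n => (hC n).nonempty x) ((hC 0).isCompact x)
    fun n => ((hC n).isCompact x).isClosed
  isCompact x := ((hC 0).isCompact x).of_isClosed_subset
    (isClosed_iInter fun n => ((hC n).isCompact x).isClosed) (iInter_subset _ 0)
  measurableSet K hK := by
    have key : {x | ((⋂ n, C n x) ∩ K).Nonempty} = ⋂ n, {x | (C n x ∩ K).Nonempty} := by
      ext x
      simp only [mem_ofPred_eq, mem_iInter]
      constructor
      · rintro ⟨p, hp, hpK⟩ n
        exact ⟨p, mem_iInter.1 hp n, hpK⟩
      · intro h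
        obtain ⟨p, hp⟩ := IsCompact.nonempty_iInter_of_sequence_nonempty_isCompact_isClosed
          (fun n => C n x ∩ K) (fun n => inter_subset_inter_left _ (hanti n x)) h
          (((hC 0).isCompact x).inter_right hK)
          fun n => ((hC n).isCompact x).isClosed.inter hK
        rw [mem_iInter] at hp
        exact ⟨p, mem_iInter.2 fun n => (hp n).1, (hp 0).2⟩
    rw [key]
    exact MeasurableSet.iInter fun n => (hC n).measurableSet K hK

theorem IsMeasurableCompactValued.iInter_iterArgmax [T2Space Y] {C : X → Set Y}
    (hC : IsMeasurableCompactValued C) {F : ℕ → Y → ℝ≥0∞} (hF : ∀ n, Continuous (F n)) :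
    IsMeasurableCompactValued fun x => ⋂ n, iterArgmax F C n x := by
  refine IsMeasurableCompactValued.iInter (fun n => ?_) fun n x => argmaxOn_subset _ _ _
  induction n with
  | zero => exact hC
  | succ n ih => exact ih.argmaxOn (hF n)

/-- A single-valued measurable multifunction is a Borel map. -/
theorem IsMeasurableCompactValued.measurable_of_eq {C : X → Set Y}
    (hC : IsMeasurableCompactValued C) {R : X → Y} (hR : ∀ x, R x ∈ C x)
    (huniq : ∀ x, ∀ p ∈ C x, p = R x) : Measurable[‹MeasurableSpace X›, borel Y] R := by
  rw [borel_eq_generateFrom_isClosed]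
  refine @measurable_generateFrom _ _ _ _ _ fun K hK => ?_
  convert hC.measurableSet K hK using 1
  ext x
  constructor
  · exact fun h => ⟨R x, hR x, h⟩
  · rintro ⟨p, hp, hpK⟩
    rw [mem_preimage, ← huniq x p hp]
    exact hpK

/-- Measurable selection: successive maximization of countably many continuous functions that
separate points leaves exactly one point of each value. -/
theorem IsMeasurableCompactValued.exists_measurable_selection [T2Space Y] {C : X → Set Y}
    (hC : IsMeasurableCompactValued C) {F : ℕ → Y → ℝ≥0∞} (hF : ∀ n, Continuous (F n))
    (hsep : ∀ p q, (∀ n, F n p = F n q) → p = q) :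
    ∃ R : X → Y, Measurable[‹MeasurableSpace X›, borel Y] R ∧ ∀ x, R x ∈ C x := by
  have hD := hC.iInter_iterArgmax hF
  choose R hR using hD.nonempty
  exact ⟨R, hD.measurable_of_eq hR fun x p hp =>
    hsep p (R x) (eq_of_mem_iInter_iterArgmax hp (hR x)), fun x => mem_iInter.1 (hR x) 0⟩

end Multifunction

/-! ### Countable families that determine measures -/

section Determining

variable {E : Type*} [TopologicalSpace E] [PolishSpace E]

/-- A family of nonnegative bounded continuous functions that contains `1`, is closed under
multiplication and separates points determines finite measures, by Stone–Weierstrass. -/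
theorem ext_of_mul_family [MeasurableSpace E] [BorelSpace E] {ι : Type*} {f : ι → E →ᵇ ℝ≥0}
    (hone : ∃ i, ∀ x, f i x = 1) (hmul : ∀ i j, ∃ k, ∀ x, f k x = f i x * f j x)
    (hsep : ∀ x y, (∀ i, f i x = f i y) → x = y) {μ ν : Measure E} [IsFiniteMeasure μ]
    [IsFiniteMeasure ν] (h : ∀ i, ∫⁻ x, f i x ∂μ = ∫⁻ x, f i x ∂ν) : μ = ν := by
  let g : ι → E →ᵇ ℝ := fun i =>
    BoundedContinuousFunction.comp _ NNReal.isometry_coe.lipschitz (f i)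
  have hg : ∀ i x, g i x = f i x := fun i x => rfl
  let S := Submodule.span ℝ (range g)
  have h1 : (1 : E →ᵇ ℝ) ∈ S := by
    obtain ⟨i, hi⟩ := hone
    refine Submodule.subset_span ⟨i, ?_⟩
    ext x; simp [hg, hi]
  have h2 : ∀ a b, a ∈ S → b ∈ S → a * b ∈ S := by
    intro a b ha hb
    have : S * S ≤ S := by
      rw [Submodule.span_mul_span]
      refine Submodule.span_mono ?_
      rintro _ ⟨_, ⟨i, rfl⟩, _, ⟨j, rfl⟩, rfl⟩
      obtain ⟨k, hk⟩ := hmul i j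
      exact ⟨k, by ext x; simp [hg, hk]⟩
    exact this (Submodule.mul_mem_mul ha hb)
  let A : StarSubalgebra ℝ (E →ᵇ ℝ) :=
    { S.toSubalgebra h1 h2 with
      star_mem' := fun {a} ha => by
        have : star a = a := by ext x; simp
        rw [this]; exact ha }
  have hmem : ∀ a, a ∈ A ↔ a ∈ S := fun a => Iff.rfl
  refine ext_of_forall_mem_subalgebra_integral_eq_of_polish (𝕜 := ℝ) (A := A) ?_ ?_
  · intro x y hxy
    by_contra! hcon
    refine hxy (hsep x y fun i => ?_)
    have := hcon (g i) ⟨g i, ⟨g i, (hmem _).2 (Submodule.subset_span ⟨i, rfl⟩), rfl⟩, rfl⟩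
    exact NNReal.coe_injective this
  · intro a ha
    rw [hmem] at ha
    induction ha using Submodule.span_induction with
    | mem a ha =>
      obtain ⟨i, rfl⟩ := ha
      have e : ∀ (ρ : Measure E), ∫ x, g i x ∂ρ = (∫⁻ x, f i x ∂ρ).toReal := fun ρ => by
        simp_rw [hg]
        rw [integral_eq_lintegral_of_nonneg_ae
          (Filter.Eventually.of_forall fun x => NNReal.coe_nonneg (f i x))
          (NNReal.continuous_coe.comp (f i).continuous).aestronglyMeasurable]
        simp
      rw [e, e, h]
    | zero => simp
    | add a b _ _ iha ihb =>
      simp only [BoundedContinuousFunction.coe_add, Pi.add_apply]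
      rw [integral_add (a.integrable μ) (b.integrable μ),
        integral_add (a.integrable ν) (b.integrable ν), iha, ihb]
    | smul r a _ iha =>
      simp only [BoundedContinuousFunction.coe_smul, smul_eq_mul]
      rw [integral_const_mul, integral_const_mul, iha]

variable (E) in
/-- The witnesses are the finite products of truncated distances to the points of a dense
sequence. -/
theorem exists_mul_family : ∃ f : List ℕ → E →ᵇ ℝ≥0, (∀ x, f [] x = 1) ∧
    (∀ l l' x, f (l ++ l') x = f l x * f l' x) ∧ ∀ x y, (∀ l, f l x = f l y) → x = y := by
  rcases isEmpty_or_nonempty E with hE | hE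
  · exact ⟨fun _ => 1, fun x => isEmptyElim x, fun _ _ x => isEmptyElim x,
      fun x => isEmptyElim x⟩
  let := TopologicalSpace.upgradeIsCompletelyMetrizable E
  let d := TopologicalSpace.denseSeq E
  let g : ℕ → E →ᵇ ℝ≥0 := fun n =>
    BoundedContinuousFunction.mkOfBound ⟨fun x => min 1 (nndist x (d n)), by fun_prop⟩ 1
      fun x y => by
        rw [NNReal.dist_eq, abs_sub_le_iff]
        have h0 : ∀ z, (((min 1 (nndist z (d n)) : ℝ≥0)) : ℝ) ≤ 1 := fun z =>
          NNReal.coe_le_one.2 (min_le_left _ _)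
        have h1 := h0 x
        have h2 := h0 y
        have h3 := (min 1 (nndist x (d n)) : ℝ≥0).2
        have h4 := (min 1 (nndist y (d n)) : ℝ≥0).2
        simp only [ContinuousMap.coe_mk]
        constructor <;> linarith
  refine ⟨fun l => (l.map g).prod, fun x => by simp, fun l l' x => by simp, fun x y h => ?_⟩
  have hxy : ∀ n, min 1 (nndist x (d n)) = min 1 (nndist y (d n)) := fun n => by
    have := h [n]
    simp only [List.map_cons, List.map_nil, List.prod_cons, List.prod_nil, mul_one] at this
    exact this
  have hcl : x ∈ closure (range d) := TopologicalSpace.denseRange_denseSeq E x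
  have hall : min 1 (nndist x x) = min 1 (nndist y x) := by
    have hc : IsClosed {z | min 1 (nndist x z) = min 1 (nndist y z)} :=
      isClosed_eq (by fun_prop) (by fun_prop)
    exact closure_minimal (by rintro _ ⟨n, rfl⟩; exact hxy n) hc hcl
  have h0 : nndist y x = 0 := by
    rw [nndist_self, min_eq_right zero_le_one] at hall
    rcases min_choice 1 (nndist y x) with h1 | h1
    · rw [h1] at hall; simp at hall
    · rw [h1] at hall; exact hall.symm
  exact (nndist_eq_zero.1 h0).symm

/-- On a Polish space, countably many bounded continuous functions determine the probability
measures, so measurable compact-valued multifunctions with values in the probability measures have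
measurable selections. -/
theorem IsMeasurableCompactValued.exists_selection_probabilityMeasure {X : Type*}
    [MeasurableSpace X] [MeasurableSpace E] [BorelSpace E] {C : X → Set (ProbabilityMeasure E)}
    (hC : IsMeasurableCompactValued C) :
    ∃ R : X → ProbabilityMeasure E,
      Measurable[‹MeasurableSpace X›, borel (ProbabilityMeasure E)] R ∧ ∀ x, R x ∈ C x := by
  let := TopologicalSpace.upgradeIsCompletelyMetrizable E
  obtain ⟨f, h1, h2, h3⟩ := exists_mul_family E
  refine hC.exists_measurable_selection (F := fun n P =>
    ∫⁻ x, f (Denumerable.ofNat (List ℕ) n) x ∂(P : Measure E))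
    (fun n => ProbabilityMeasure.continuous_lintegral_boundedContinuousFunction _) ?_
  intro P Q h
  have hPQ : (P : Measure E) = Q :=
    ext_of_mul_family (f := f) ⟨[], h1⟩ (fun l l' => ⟨l ++ l', h2 l l'⟩) h3 fun l => ?_
  · exact Subtype.ext hPQ
  simpa using h (Encodable.encode l)

end Determining

/-! ### The exponential law on the half-line -/

/-- The exponential law with rate `1`, as a measure on `ℝ≥0`. -/
noncomputable def expLaw : Measure ℝ≥0 :=
  ((volume.restrict (Ioi (0 : ℝ))).withDensity fun t => ENNReal.ofReal (Real.exp (-t))).map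
    Real.toNNReal

theorem lintegral_expLaw {g : ℝ≥0 → ℝ≥0∞} (hg : Measurable g) :
    ∫⁻ t, g t ∂expLaw = ∫⁻ t in Ioi (0 : ℝ), ENNReal.ofReal (Real.exp (-t)) * g t.toNNReal := by
  have hg' : Measurable fun t : ℝ => g t.toNNReal := hg.comp measurable_real_toNNReal
  rw [expLaw, lintegral_map hg measurable_real_toNNReal,
    lintegral_withDensity_eq_lintegral_mul _ (by fun_prop) hg']
  rfl

instance : IsProbabilityMeasure expLaw := by
  constructor
  have h := lintegral_expLaw (g := fun _ => 1) measurable_const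
  simp only [lintegral_const, one_mul, mul_one] at h
  rw [h, ← ofReal_integral_eq_lintegral_ofReal (integrableOn_exp_neg_Ioi 0)
    (Filter.Eventually.of_forall fun t => (Real.exp_pos _).le), integral_exp_neg_Ioi_zero,
    ENNReal.ofReal_one]

instance : expLaw.IsOpenPosMeasure := by
  constructor
  rintro U hU ⟨x, hx⟩
  rw [← lintegral_indicator_one hU.measurableSet,
    lintegral_expLaw (measurable_one.indicator hU.measurableSet)]
  refine ne_of_gt ?_
  have hmeas : Measurable fun t : ℝ =>
      ENNReal.ofReal (Real.exp (-t)) * U.indicator (1 : ℝ≥0 → ℝ≥0∞) t.toNNReal :=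
    (by fun_prop : Measurable fun t : ℝ => ENNReal.ofReal (Real.exp (-t))).mul
      ((measurable_one.indicator hU.measurableSet).comp measurable_real_toNNReal)
  rw [setLIntegral_pos_iff hmeas]
  have hV : IsOpen (Real.toNNReal ⁻¹' U ∩ Ioi 0) :=
    (hU.preimage continuous_real_toNNReal).inter isOpen_Ioi
  have hne : (Real.toNNReal ⁻¹' U ∩ Ioi 0).Nonempty := by
    -- `x` itself may be `0`, so a nearby positive point is taken
    obtain ⟨y, hyU, hy⟩ : ∃ y ∈ U, x < y := by
      have h1 : U ∈ 𝓝[>] x := mem_nhdsWithin_of_mem_nhds (hU.mem_nhds hx)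
      obtain ⟨y, hy⟩ := Filter.nonempty_of_mem (Filter.inter_mem h1 self_mem_nhdsWithin)
      exact ⟨y, hy.1, hy.2⟩
    exact ⟨y, by simpa using hyU, NNReal.coe_pos.2 (lt_of_le_of_lt zero_le hy)⟩
  refine (hV.measure_pos volume hne).trans_le (measure_mono ?_)
  rintro t ⟨ht, ht0⟩
  refine ⟨?_, ht0⟩
  have ht' : t.toNNReal ∈ U := ht
  simp [ht', Real.exp_pos]

/-- The lack of memory of the exponential law. -/
theorem lintegral_expLaw_split (s : ℝ≥0) {g : ℝ≥0 → ℝ≥0∞} (hg : Measurable g) :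
    ∫⁻ t, g t ∂expLaw = ∫⁻ t in Iic s, g t ∂expLaw +
      ENNReal.ofReal (Real.exp (-s)) * ∫⁻ t, g (s + t) ∂expLaw := by
  rw [← lintegral_add_compl g measurableSet_Iic, compl_Iic]
  congr 1
  have hexp : Measurable fun t : ℝ => ENNReal.ofReal (Real.exp (-t)) := by fun_prop
  have hgs : Measurable fun t => g (s + t) := hg.comp (measurable_const_add s)
  have hgs' : Measurable fun t : ℝ => g (s + t.toNNReal) :=
    hgs.comp measurable_real_toNNReal
  have hprod : Measurable fun t : ℝ =>
      ENNReal.ofReal (Real.exp (-t)) * g (s + t.toNNReal) := hexp.mul hgs'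
  rw [← lintegral_indicator measurableSet_Ioi, lintegral_expLaw (hg.indicator measurableSet_Ioi),
    lintegral_expLaw hgs, ← lintegral_const_mul _ hprod,
    ← lintegral_indicator measurableSet_Ioi, ← lintegral_indicator measurableSet_Ioi,
    ← lintegral_add_left_eq_self _ (s : ℝ)]
  refine lintegral_congr fun t => ?_
  by_cases ht : 0 < t
  · have h1 : (s : ℝ) + t ∈ Ioi (0 : ℝ) := by
      have := s.2
      exact add_pos_of_nonneg_of_pos this ht
    have h2 : ((s : ℝ) + t).toNNReal = s + t.toNNReal := by
      rw [Real.toNNReal_add (NNReal.coe_nonneg s) ht.le, Real.toNNReal_coe]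
    have h3 : s + t.toNNReal ∈ Ioi s := by
      simpa using ht
    rw [indicator_of_mem h1, indicator_of_mem (show t ∈ Ioi (0 : ℝ) from ht), h2,
      indicator_of_mem h3, neg_add, Real.exp_add, ENNReal.ofReal_mul (Real.exp_pos _).le, mul_assoc]
  · rw [indicator_of_notMem (show t ∉ Ioi (0 : ℝ) from ht)]
    refine indicator_apply_eq_zero.2 fun _ => ?_
    rw [indicator_of_notMem, mul_zero]
    rw [mem_Ioi, not_lt, ← NNReal.coe_le_coe]
    rw [Real.coe_toNNReal']
    exact max_le (by linarith) s.2

/-! ### Discounted functionals of a path -/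

section Discounted

variable {X : Type*} [TopologicalSpace X]

/-- The functional `w ↦ ∫ h (t, w t) e⁻ᵗ dt`. -/
theorem exists_expLaw_functional [PolishSpace X] (h : (ℝ≥0 × X) →ᵇ ℝ≥0) : ∃ G : PathSpace X →ᵇ ℝ≥0,
    ∀ w, (G w : ℝ≥0∞) = ∫⁻ t, h (t, w t) ∂expLaw := by
  obtain ⟨b, hb⟩ : ∃ b : ℝ≥0, ∀ z, h z ≤ b := by
    obtain ⟨b, hb⟩ := h.isBounded_range.bddAbove
    exact ⟨b, fun z => hb ⟨z, rfl⟩⟩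
  have hle : ∀ w : PathSpace X, ∫⁻ t, h (t, w t) ∂expLaw ≤ b := fun w => by
    calc ∫⁻ t, h (t, w t) ∂expLaw ≤ ∫⁻ _, (b : ℝ≥0∞) ∂expLaw :=
          lintegral_mono fun t => ENNReal.coe_le_coe.2 (hb _)
      _ = b := by simp
  have htop : ∀ w : PathSpace X, ∫⁻ t, h (t, w t) ∂expLaw ≠ ∞ := fun w =>
    ne_top_of_le_ne_top ENNReal.coe_ne_top (hle w)
  have hcont : Continuous fun w : PathSpace X => ∫⁻ t, (h (t, w t) : ℝ≥0∞) ∂expLaw := by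
    refine continuous_iff_continuousAt.2 fun w => ?_
    have : (𝓝 w).IsCountablyGenerated := by
      let := TopologicalSpace.upgradeIsCompletelyMetrizable (PathSpace X)
      infer_instance
    refine tendsto_lintegral_filter_of_dominated_convergence (fun _ => (b : ℝ≥0∞))
      (Filter.Eventually.of_forall fun v => ?_)
      (Filter.Eventually.of_forall fun v => Filter.Eventually.of_forall fun t =>
        ENNReal.coe_le_coe.2 (hb _)) (by simp) (Filter.Eventually.of_forall fun t => ?_)
    · exact (ENNReal.continuous_coe.comp (h.continuous.comp (by fun_prop))).measurable
    · have : Continuous fun v : PathSpace X => (h (t, v t) : ℝ≥0∞) :=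
        ENNReal.continuous_coe.comp (h.continuous.comp (by fun_prop))
      exact this.tendsto w
  refine ⟨BoundedContinuousFunction.mkOfBound
    ⟨fun w => (∫⁻ t, h (t, w t) ∂expLaw).toNNReal, ?_⟩ b fun v w => ?_, fun w => ?_⟩
  · exact ENNReal.continuousOn_toNNReal.comp_continuous hcont htop
  · have hv : ((∫⁻ t, h (t, v t) ∂expLaw).toNNReal : ℝ) ≤ b :=
      NNReal.coe_le_coe.2 (ENNReal.toNNReal_mono ENNReal.coe_ne_top (hle v))
    have hw : ((∫⁻ t, h (t, w t) ∂expLaw).toNNReal : ℝ) ≤ b :=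
      NNReal.coe_le_coe.2 (ENNReal.toNNReal_mono ENNReal.coe_ne_top (hle w))
    have hv0 := (∫⁻ t, h (t, v t) ∂expLaw).toNNReal.2
    have hw0 := (∫⁻ t, h (t, w t) ∂expLaw).toNNReal.2
    rw [NNReal.dist_eq, abs_sub_le_iff]
    simp only [ContinuousMap.coe_mk]
    constructor <;> linarith
  · exact ENNReal.coe_toNNReal (htop w)

variable [MeasurableSpace X] [BorelSpace X]

/-- A functional `G` of the path that splits at each time `s` into a functional of the path up
to time `s` and a positive multiple of `G` applied to the path after time `s`. -/
def IsDiscounted (G : PathSpace X →ᵇ ℝ≥0) : Prop :=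
  ∀ s : ℝ≥0, ∃ c : ℝ≥0∞, c ≠ 0 ∧ c ≠ ∞ ∧ ∃ H : PathSpace X → ℝ≥0∞,
    Measurable[pathFiltration X s] H ∧ ∀ w, (G w : ℝ≥0∞) = H w + c * G (shift s w)

theorem measurable_coord_of_le {s t : ℝ≥0} (h : t ≤ s) :
    Measurable[pathFiltration X s] fun w : PathSpace X => w t :=
  Measurable.of_comap_le (le_iSup_of_le t (le_iSup_of_le h le_rfl))

variable [PolishSpace X]

theorem isDiscounted_of_forall_eq {h : (ℝ≥0 × X) →ᵇ ℝ≥0} {G : PathSpace X →ᵇ ℝ≥0}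
    (hG : ∀ w, (G w : ℝ≥0∞) = ∫⁻ t, h (t, w t) ∂expLaw)
    (hh : ∀ s, ∃ c : ℝ≥0, c ≠ 0 ∧ ∀ t x, h (s + t, x) = c * h (t, x)) : IsDiscounted G := by
  intro s
  obtain ⟨c, hc, hcs⟩ := hh s
  refine ⟨ENNReal.ofReal (Real.exp (-s)) * c, ?_, ENNReal.mul_ne_top (by simp) (by simp),
    fun w => ∫⁻ t in Iic s, h (t, w (min t s)) ∂expLaw, ?_, fun w => ?_⟩
  · refine mul_ne_zero ?_ (by simpa using hc)
    simp [Real.exp_pos]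
  · -- on `Iic s` the path may be stopped at time `s`, which makes the integrand jointly measurable
    -- with respect to `𝓕_s`
    have hu : @Measurable (ℝ≥0 × PathSpace X) X
        (@Prod.instMeasurableSpace _ _ _ (pathFiltration X s)) _
        (Function.uncurry fun (t : ℝ≥0) (w : PathSpace X) => w (min t s)) :=
      @measurable_uncurry_of_continuous_of_measurable _ _ _ _ _ _ _ _ _ _ _ _
        (pathFiltration X s) _ (fun w => by fun_prop)
        (fun t => measurable_coord_of_le (min_le_right t s))
    have hpair : @Measurable (PathSpace X × ℝ≥0) (ℝ≥0 × X)
        (@Prod.instMeasurableSpace _ _ (pathFiltration X s) _) _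
        fun p => (p.2, p.1 (min p.2 s)) := by
      refine @Measurable.prodMk _ _ _ _ _ (_) _ _ (@measurable_snd _ _ (pathFiltration X s) _) ?_
      exact hu.comp (@measurable_swap _ _ (pathFiltration X s) _)
    exact @Measurable.lintegral_prod_right' _ _ (pathFiltration X s) _ _ _ _
      (measurable_coe_nnreal_ennreal.comp (h.continuous.measurable.comp hpair))
  · have hm : ∀ v : PathSpace X, Measurable fun t => (h (t, v t) : ℝ≥0∞) := fun v =>
      (ENNReal.continuous_coe.comp (h.continuous.comp (by fun_prop))).measurable
    rw [hG, lintegral_expLaw_split s (hm w), hG, mul_assoc]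
    congr 1
    · refine setLIntegral_congr_fun measurableSet_Iic fun t ht => ?_
      simp only [min_eq_left (show t ≤ s from ht)]
    · rw [← lintegral_const_mul _ (hm _)]
      simp only [hcs, shift_apply, ENNReal.coe_mul]

/-- Countably many discounted functionals whose expectations determine the law of the path at
each single time: Laplace transforms, in the time variable, of the members of a determining
family of functions on `X`. -/
theorem exists_isDiscounted_determining (X : Type*) [TopologicalSpace X] [MeasurableSpace X]
    [BorelSpace X] [PolishSpace X] : ∃ G : ℕ → PathSpace X →ᵇ ℝ≥0, (∀ n, IsDiscounted (G n)) ∧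
      ∀ P P' : ProbabilityMeasure (PathSpace X),
        (∀ n, ∫⁻ w, G n w ∂(P : Measure (PathSpace X)) =
          ∫⁻ w, G n w ∂(P' : Measure (PathSpace X))) →
        ∀ t : ℝ≥0, (P : Measure (PathSpace X)).map (fun w => w t) =
          (P' : Measure (PathSpace X)).map fun w => w t := by
  obtain ⟨f, hf1, hf2, hf3⟩ := exists_mul_family X
  let e : ℝ≥0 →ᵇ ℝ≥0 := BoundedContinuousFunction.mkOfBound
    ⟨fun t => (Real.exp (-t)).toNNReal, by fun_prop⟩ 1 fun s t => by
      have h0 : ∀ r : ℝ≥0, Real.exp (-r) ≤ 1 := fun r =>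
        Real.exp_le_one_iff.2 (neg_nonpos.2 r.2)
      rw [NNReal.dist_eq, abs_sub_le_iff]
      simp only [ContinuousMap.coe_mk, Real.coe_toNNReal _ (Real.exp_pos _).le]
      have := h0 s; have := h0 t; have := Real.exp_pos (-s); have := Real.exp_pos (-t)
      constructor <;> linarith
  have he : ∀ t, e t = (Real.exp (-t)).toNNReal := fun t => rfl
  have hadd : ∀ s t, e (s + t) = e s * e t := fun s t => by
    rw [he, he, he, NNReal.coe_add, neg_add, Real.exp_add, Real.toNNReal_mul (Real.exp_pos _).le]
  have hpos : ∀ s, e s ≠ 0 := fun s => by simp [he, Real.exp_pos]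
  have hinj : ∀ s t, e s = e t → s = t := fun s t h => by
    rw [he, he, Real.toNNReal_eq_toNNReal_iff (Real.exp_pos _).le (Real.exp_pos _).le] at h
    simpa using h
  let h : ℕ × List ℕ → (ℝ≥0 × X) →ᵇ ℝ≥0 := fun i =>
    (e ^ i.1).compContinuous ⟨Prod.fst, by fun_prop⟩ *
      (f i.2).compContinuous ⟨Prod.snd, by fun_prop⟩
  have hh : ∀ i t x, h i (t, x) = e t ^ i.1 * f i.2 x := fun i t x => by simp [h]
  choose G hG using fun i => exists_expLaw_functional (h i)
  refine ⟨fun n => G (Denumerable.ofNat _ n), fun n => isDiscounted_of_forall_eq (hG _) fun s =>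
    ⟨e s ^ (Denumerable.ofNat (ℕ × List ℕ) n).1, pow_ne_zero _ (hpos s), fun t x => ?_⟩, ?_⟩
  · rw [hh, hh, hadd, mul_pow, mul_assoc]
  intro P P' hPP'
  have hev : Measurable fun q : ℝ≥0 × PathSpace X => (q.1, q.2 q.1) :=
    Continuous.measurable (by fun_prop)
  -- the law of `(T, w T)` for an independent exponential time `T`
  let M : ProbabilityMeasure (PathSpace X) → Measure (ℝ≥0 × X) := fun R =>
    (expLaw.prod (R : Measure (PathSpace X))).map fun q => (q.1, q.2 q.1)
  have hMprob : ∀ R, IsProbabilityMeasure (M R) := fun R =>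
    Measure.isProbabilityMeasure_map hev.aemeasurable
  have hM : ∀ R (φ : ℝ≥0 × X → ℝ≥0∞), Measurable φ → ∫⁻ z, φ z ∂(M R) =
      ∫⁻ t, ∫⁻ w, φ (t, w t) ∂(R : Measure (PathSpace X)) ∂expLaw := fun R φ hφ => by
    have hφ' : Measurable fun q : ℝ≥0 × PathSpace X => φ (q.1, q.2 q.1) := hφ.comp hev
    rw [lintegral_map hφ hev, lintegral_prod _ hφ'.aemeasurable]
  have hMG : ∀ R i, ∫⁻ z, h i z ∂(M R) = ∫⁻ w, G i w ∂(R : Measure (PathSpace X)) := by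
    intro R i
    have hmeas : Measurable fun z => (h i z : ℝ≥0∞) :=
      (ENNReal.continuous_coe.comp (h i).continuous).measurable
    have hmeas' : Measurable fun q : ℝ≥0 × PathSpace X => (h i (q.1, q.2 q.1) : ℝ≥0∞) :=
      hmeas.comp hev
    rw [lintegral_map hmeas hev, lintegral_prod_symm _ hmeas'.aemeasurable]
    exact lintegral_congr fun w => (hG i w).symm
  have hMeq : M P = M P' := by
    refine ext_of_mul_family (f := h) ⟨(0, []), fun z => ?_⟩ (fun i j =>
      ⟨(i.1 + j.1, i.2 ++ j.2), fun z => ?_⟩) (fun z z' hzz' => ?_) fun i => ?_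
    · rw [hh, hf1]; simp
    · rw [hh, hh, hh, hf2, pow_add]; ring
    · obtain ⟨t, x⟩ := z
      obtain ⟨t', x'⟩ := z'
      have h1 := hzz' (1, [])
      rw [hh, hh, hf1, hf1] at h1
      have h2 : ∀ l, f l x = f l x' := fun l => by
        have := hzz' (0, l)
        rw [hh, hh] at this
        simpa using this
      rw [hinj t t' (by simpa using h1), hf3 x x' h2]
    · rw [hMG, hMG]
      obtain ⟨n, rfl⟩ : ∃ n, Denumerable.ofNat (ℕ × List ℕ) n = i :=
        (Denumerable.eqv (ℕ × List ℕ)).symm.surjective i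
      exact hPP' n
  -- for each test function, the expectations at time `t` agree for almost every `t`, hence for
  -- every `t` by continuity
  have key : ∀ g : X →ᵇ ℝ≥0, ∀ t, ∫⁻ w : PathSpace X, g (w t) ∂(P : Measure (PathSpace X)) =
      ∫⁻ w : PathSpace X, g (w t) ∂(P' : Measure (PathSpace X)) := by
    intro g
    obtain ⟨b, hb⟩ : ∃ b : ℝ≥0, ∀ z, g z ≤ b := by
      obtain ⟨b, hb⟩ := g.isBounded_range.bddAbove
      exact ⟨b, fun z => hb ⟨z, rfl⟩⟩
    have hcont : ∀ R : ProbabilityMeasure (PathSpace X), Continuous fun t : ℝ≥0 =>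
        ∫⁻ w : PathSpace X, (g (w t) : ℝ≥0∞) ∂(R : Measure (PathSpace X)) := fun R => by
      refine continuous_iff_continuousAt.2 fun t => ?_
      refine tendsto_lintegral_filter_of_dominated_convergence (fun _ => (b : ℝ≥0∞))
        (Filter.Eventually.of_forall fun v => ?_)
        (Filter.Eventually.of_forall fun v => Filter.Eventually.of_forall fun t =>
          ENNReal.coe_le_coe.2 (hb _)) (by simp) (Filter.Eventually.of_forall fun w => ?_)
      · exact (ENNReal.continuous_coe.comp (g.continuous.comp (by fun_prop))).measurable
      · have : Continuous fun t => (g (w t) : ℝ≥0∞) :=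
          ENNReal.continuous_coe.comp (g.continuous.comp (by fun_prop))
        exact this.tendsto t
    refine congrFun ((Continuous.ae_eq_iff_eq expLaw (hcont P) (hcont P')).1 ?_)
    refine ae_eq_of_forall_setLIntegral_eq_of_sigmaFinite (hcont P).measurable
      (hcont P').measurable fun B hB _ => ?_
    have hφ : Measurable fun z : ℝ≥0 × X => B.indicator 1 z.1 * (g z.2 : ℝ≥0∞) :=
      ((measurable_one.indicator hB).comp measurable_fst).mul
        (measurable_coe_nnreal_ennreal.comp (g.continuous.measurable.comp measurable_snd))
    have e1 : ∀ R : ProbabilityMeasure (PathSpace X),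
        ∫⁻ t in B, ∫⁻ w : PathSpace X, (g (w t) : ℝ≥0∞) ∂(R : Measure (PathSpace X)) ∂expLaw =
          ∫⁻ z, B.indicator 1 z.1 * (g z.2 : ℝ≥0∞) ∂(M R) := fun R => by
      rw [hM R _ hφ, ← lintegral_indicator hB]
      refine lintegral_congr fun t => ?_
      by_cases ht : t ∈ B <;> simp [ht]
    rw [e1, e1, hMeq]
  intro t
  have ht : Measurable fun w : PathSpace X => w t := measurable_coord t
  have := Measure.isProbabilityMeasure_map (μ := (P : Measure (PathSpace X))) ht.aemeasurable
  let := TopologicalSpace.upgradeIsCompletelyMetrizable X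
  refine ext_of_forall_lintegral_eq_of_IsFiniteMeasure fun g => ?_
  have hg : Measurable fun x => (g x : ℝ≥0∞) :=
    (ENNReal.continuous_coe.comp g.continuous).measurable
  rw [lintegral_map hg ht, lintegral_map hg ht]
  exact key g t

end Discounted

/-! ### Families of laws that are stable under conditioning and concatenation -/

section MarkovFamily

variable {X : Type*} [TopologicalSpace X] [MeasurableSpace X] [BorelSpace X]

theorem isMeasurableFamily_comp_coord {R : X → ProbabilityMeasure (PathSpace X)}
    (hR : Measurable[‹MeasurableSpace X›, borel (ProbabilityMeasure (PathSpace X))] R) (s : ℝ≥0) :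
    IsMeasurableFamily s fun w => R (w s) := by
  intro f
  have hc : Continuous fun P : ProbabilityMeasure (PathSpace X) =>
      ∫ v, f v ∂(P : Measure (PathSpace X)) :=
    ProbabilityMeasure.continuous_integral_boundedContinuousFunction f
  refine @measurable_of_isOpen _ _ _ _ _ (pathFiltration X s) _ fun U hU => ?_
  exact measurable_coord_of_le le_rfl
    (hR (MeasurableSpace.measurableSet_generateFrom (hU.preimage hc)))

variable [PolishSpace X]

/-- A measurable compact-valued choice of sets of laws, `C x` consisting of laws of paths that
start at `x`, that is stable under conditioning on the past and under concatenation. -/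
structure IsMarkovFamily (C : X → Set (ProbabilityMeasure (PathSpace X))) : Prop
    extends IsMeasurableCompactValued C where
  start : ∀ x, ∀ P ∈ C x, (P : Measure (PathSpace X)) (pathsFrom x) = 1
  condLaw : ∀ x, ∀ P ∈ C x, ∀ s : ℝ≥0, AlmostSurelyIn P s fun w => condLawShift P s w ∈ C (w s)
  concat : ∀ (s : ℝ≥0) (Q : PathSpace X → ProbabilityMeasure (PathSpace X)),
    IsMeasurableFamily s Q → (∀ w, Q w ∈ C (w s)) →
      ∀ x, ∀ P ∈ C x, ∀ R, IsConcat P s Q R → R ∈ C x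

theorem isMeasurableFamily_condLawShift (P : ProbabilityMeasure (PathSpace X)) (s : ℝ≥0) :
    IsMeasurableFamily s (condLawShift P s) := by
  intro f
  have h : StronglyMeasurable fun v => f (shift s v) :=
    (f.continuous.comp (continuous_shift s)).stronglyMeasurable
  have h2 := (h.integral_condExpKernel' (μ := (P : Measure (PathSpace X)))
    (m := pathFiltration X s)).measurable.mono inf_le_left le_rfl
  convert h2 using 2 with w
  exact integral_map (measurable_shift s).aemeasurable f.continuous.aestronglyMeasurable

/-- Every law is the concatenation of itself with its own conditional laws, so the formulas for
concatenations apply to it. -/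
theorem isConcat_condLawShift (P : ProbabilityMeasure (PathSpace X)) (s : ℝ≥0) :
    IsConcat P s (condLawShift P s) P :=
  ⟨fun _ _ => rfl, Filter.Eventually.of_forall fun _ => rfl⟩

theorem IsMeasurableFamily.measurable_lintegral {s : ℝ≥0}
    {Q : PathSpace X → ProbabilityMeasure (PathSpace X)} (hQ : IsMeasurableFamily s Q)
    {φ : PathSpace X → ℝ≥0∞} (hφ : Measurable φ) :
    Measurable[pathFiltration X s] fun w => ∫⁻ v, φ v ∂(Q w : Measure (PathSpace X)) :=
  (Measure.measurable_lintegral hφ).comp hQ.measurable_apply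

/-- Under `P ⊗_s Q`, the past up to time `s` has the law it has under `P`, and the law of the
future is the `P`-average of `Q`. -/
theorem IsConcat.lintegral_add {P R : ProbabilityMeasure (PathSpace X)} {s : ℝ≥0}
    {Q : PathSpace X → ProbabilityMeasure (PathSpace X)} (hQ : IsMeasurableFamily s Q)
    (hR : IsConcat P s Q R) {H : PathSpace X → ℝ≥0∞} (hH : Measurable[pathFiltration X s] H)
    (c : ℝ≥0∞) {φ : PathSpace X → ℝ≥0∞} (hφ : Measurable φ) :
    ∫⁻ w, (H w + c * φ (shift s w)) ∂(R : Measure (PathSpace X)) =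
      ∫⁻ w, H w ∂(P : Measure (PathSpace X)) +
        c * ∫⁻ w, ∫⁻ v, φ v ∂(Q w : Measure (PathSpace X)) ∂(P : Measure (PathSpace X)) := by
  have hm := (pathFiltration X).le s
  have hθ := measurable_shift (X := X) s
  have hQm : Measurable fun w => (Q w : Measure (PathSpace X)) :=
    hQ.measurable_apply.mono hm le_rfl
  have hφθ : Measurable fun w => φ (shift s w) := hφ.comp hθ
  rw [lintegral_add_left (hH.mono hm le_rfl), lintegral_const_mul _ hφθ]
  congr 1
  · have ht : (R : Measure (PathSpace X)).trim hm = (P : Measure (PathSpace X)).trim hm := by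
      refine @Measure.ext _ (pathFiltration X s) _ _ fun A hA => ?_
      rw [trim_measurableSet_eq hm hA, trim_measurableSet_eq hm hA, hR.agree A hA]
    rw [← lintegral_trim hm hH, ht, lintegral_trim hm hH]
  · have hb : (R : Measure (PathSpace X)).map (shift s) =
        (P : Measure (PathSpace X)).bind fun w => (Q w : Measure (PathSpace X)) := by
      ext B hB
      rw [Measure.map_apply hθ hB, Measure.bind_apply hB hQm.aemeasurable]
      simpa using (isConcat_iff hQ R).1 hR univ B MeasurableSet.univ hB
    rw [← lintegral_map hφ hθ, hb, Measure.lintegral_bind hQm.aemeasurable hφ.aemeasurable]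

/-- Keeping only the laws that maximize the expectation of a discounted functional `G` preserves
stability. By the splitting of `G`, concatenating `P` with a measurable selection of the maximizers
does not decrease the expectation of `G`; so if `P` is a maximizer, then its conditional laws are
almost surely maximizers too. -/
theorem IsMarkovFamily.argmaxOn {C : X → Set (ProbabilityMeasure (PathSpace X))}
    (hC : IsMarkovFamily C) {G : PathSpace X →ᵇ ℝ≥0} (hG : IsDiscounted G) :
    IsMarkovFamily (argmaxOn (fun P => ∫⁻ w, G w ∂(P : Measure (PathSpace X))) C) := by
  let := TopologicalSpace.upgradeIsCompletelyMetrizable (PathSpace X)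
  have hGm : Measurable fun w => (G w : ℝ≥0∞) :=
    (ENNReal.continuous_coe.comp G.continuous).measurable
  have hA := hC.toIsMeasurableCompactValued.argmaxOn
    (ProbabilityMeasure.continuous_lintegral_boundedContinuousFunction G)
  refine ⟨hA, fun x P hP => hC.start x P hP.1, fun x P hP s => ?_, ?_⟩
  · obtain ⟨R, hRm, hR⟩ := hA.exists_selection_probabilityMeasure
    obtain ⟨c, hc0, hct, H, hH, hsplit⟩ := hG s
    obtain ⟨N, hN, hPN, hNC⟩ := hC.condLaw x P hP.1 s
    have hQ1 := isMeasurableFamily_condLawShift P s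
    have hQ2 := isMeasurableFamily_comp_coord hRm s
    -- the competitor `S` follows `P` up to time `s` and is maximal from then on
    obtain ⟨S, hS, -⟩ := existsUnique_isConcat P s _ hQ2 fun w => hC.start _ _ (hR (w s)).1
    have hSC : S ∈ C x := hC.concat s _ hQ2 (fun w => (hR (w s)).1) x P hP.1 S hS
    have hm1 := hQ1.measurable_lintegral hGm
    have hm2 := hQ2.measurable_lintegral hGm
    have hle : ∀ᵐ w ∂(P : Measure (PathSpace X)),
        ∫⁻ v, G v ∂(condLawShift P s w : Measure (PathSpace X)) ≤
          ∫⁻ v, G v ∂(R (w s) : Measure (PathSpace X)) := by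
      filter_upwards [measure_eq_zero_iff_ae_notMem.1 hPN] with w hw
      exact (hR (w s)).2 _ (hNC w hw)
    have e1 := (isConcat_condLawShift P s).lintegral_add hQ1 hH c hGm
    have e2 := hS.lintegral_add hQ2 hH c hGm
    simp only [← hsplit] at e1 e2
    have hfin := (BoundedContinuousFunction.lintegral_lt_top_of_nnreal
      (P : Measure (PathSpace X)) G).ne
    have hge := hP.2 S hSC
    have hint : ∫⁻ w, ∫⁻ v, G v ∂(R (w s) : Measure (PathSpace X)) ∂(P : Measure (PathSpace X)) ≤
        ∫⁻ w, ∫⁻ v, G v ∂(condLawShift P s w : Measure (PathSpace X))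
          ∂(P : Measure (PathSpace X)) := by
      simp only [e2] at hge
      rw [e1] at hge hfin
      have h1 := (ENNReal.add_le_add_iff_left (ENNReal.add_ne_top.1 hfin).1).1 hge
      exact (ENNReal.mul_le_mul_iff_right hc0 hct).1 h1
    have hfin2 : ∫⁻ w, ∫⁻ v, G v ∂(condLawShift P s w : Measure (PathSpace X))
        ∂(P : Measure (PathSpace X)) ≠ ∞ := by
      intro htop
      rw [e1, htop, ENNReal.mul_top hc0, add_top] at hfin
      exact hfin rfl
    have hm := (pathFiltration X).le s
    have hae := ae_eq_of_ae_le_of_lintegral_le hle hfin2 (hm2.mono hm le_rfl).aemeasurable hint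
    refine ⟨N ∪ {w | ∫⁻ v, G v ∂(condLawShift P s w : Measure (PathSpace X)) ≠
      ∫⁻ v, G v ∂(R (w s) : Measure (PathSpace X))}, ?_, ?_, ?_⟩
    · refine @MeasurableSet.union _ (pathFiltration X s) _ _ hN ?_
      exact @MeasurableSet.compl _ _ (pathFiltration X s)
        (measurableSet_eq_fun (m := pathFiltration X s) hm1 hm2)
    · exact measure_union_null hPN hae
    · intro w hw
      simp only [mem_union, not_or, mem_ofPred_eq, not_not] at hw
      exact ⟨hNC w hw.1, fun q hq => ((hR (w s)).2 q hq).trans_eq hw.2.symm⟩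
  · intro s Q hQ hQC x P hP R hR
    refine ⟨hC.concat s Q hQ (fun w => (hQC w).1) x P hP.1 R hR, fun q hq => ?_⟩
    refine (hP.2 q hq).trans ?_
    obtain ⟨c, -, -, H, hH, hsplit⟩ := hG s
    obtain ⟨N, hN, hPN, hNC⟩ := hC.condLaw x P hP.1 s
    have e1 := (isConcat_condLawShift P s).lintegral_add (isMeasurableFamily_condLawShift P s) hH
      c hGm
    have e2 := hR.lintegral_add hQ hH c hGm
    simp only [← hsplit] at e1 e2
    simp only [e1, e2]
    refine add_le_add le_rfl (mul_le_mul' le_rfl (lintegral_mono_ae ?_))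
    filter_upwards [measure_eq_zero_iff_ae_notMem.1 hPN] with w hw
    exact (hQC w).2 _ (hNC w hw)

theorem IsMarkovFamily.iInter {C : ℕ → X → Set (ProbabilityMeasure (PathSpace X))}
    (hC : ∀ n, IsMarkovFamily (C n)) (hanti : ∀ n x, C (n + 1) x ⊆ C n x) :
    IsMarkovFamily fun x => ⋂ n, C n x := by
  let := TopologicalSpace.upgradeIsCompletelyMetrizable (PathSpace X)
  refine ⟨IsMeasurableCompactValued.iInter (fun n => (hC n).toIsMeasurableCompactValued) hanti,
    fun x P hP => (hC 0).start x P (mem_iInter.1 hP 0), fun x P hP s => ?_, ?_⟩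
  · choose N hN hPN hNC using fun n => (hC n).condLaw x P (mem_iInter.1 hP n) s
    refine ⟨⋃ n, N n, @MeasurableSet.iUnion _ _ (pathFiltration X s) _ _ hN,
      measure_iUnion_null hPN, fun w hw => mem_iInter.2 fun n => hNC n w fun h => hw ?_⟩
    exact mem_iUnion.2 ⟨n, h⟩
  · exact fun s Q hQ hQC x P hP R hR => mem_iInter.2 fun n =>
      (hC n).concat s Q hQ (fun w => mem_iInter.1 (hQC w) n) x P (mem_iInter.1 hP n) R hR

theorem IsMarkovFamily.iInter_iterArgmax {C : X → Set (ProbabilityMeasure (PathSpace X))}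
    (hC : IsMarkovFamily C) {G : ℕ → PathSpace X →ᵇ ℝ≥0} (hG : ∀ n, IsDiscounted (G n)) :
    IsMarkovFamily fun x =>
      ⋂ n, iterArgmax (fun n P => ∫⁻ w, G n w ∂(P : Measure (PathSpace X))) C n x := by
  refine IsMarkovFamily.iInter (fun n => ?_) fun n x => argmaxOn_subset _ _ _
  induction n with
  | zero => exact hC
  | succ n ih => exact ih.argmaxOn (hG n)

/-! ### Uniqueness from one-dimensional marginals -/

theorem measurableSpace_path_le_iSup : (instMeasurableSpacePath : MeasurableSpace (PathSpace X)) ≤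
    ⨆ t : ℝ≥0, MeasurableSpace.comap (fun w : PathSpace X => w t) inferInstance := by
  rw [measurableSpace_path_eq, MeasurableSpace.pi, MeasurableSpace.comap_iSup]
  refine iSup_le fun n => ?_
  rw [MeasurableSpace.comap_comp]
  exact le_iSup (fun t : ℝ≥0 => MeasurableSpace.comap (fun w : PathSpace X => w t) inferInstance)
    (TopologicalSpace.denseSeq ℝ≥0 n)

/-- The finite-dimensional distributions determine the law of the path. -/
theorem ext_of_finiteDimensional {P P' : ProbabilityMeasure (PathSpace X)}
    (h : ∀ (T : Finset ℝ≥0) (A : ℝ≥0 → Set X), (∀ t, MeasurableSet (A t)) →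
      (P : Measure (PathSpace X)) {w | ∀ t ∈ T, w t ∈ A t} =
        (P' : Measure (PathSpace X)) {w | ∀ t ∈ T, w t ∈ A t}) : P = P' := by
  classical
  let m : ℝ≥0 → MeasurableSpace (PathSpace X) := fun t =>
    MeasurableSpace.comap (fun w : PathSpace X => w t) inferInstance
  have hgen : (instMeasurableSpacePath : MeasurableSpace (PathSpace X)) =
      MeasurableSpace.generateFrom (piiUnionInter (fun t => {s | MeasurableSet[m t] s}) univ) := by
    refine Eq.trans ?_ (generateFrom_piiUnionInter_measurableSet m univ).symm
    refine le_antisymm (measurableSpace_path_le_iSup.trans_eq (by simp [m])) ?_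
    exact iSup₂_le fun t _ => (measurable_coord t).comap_le
  have hPP' : (P : Measure (PathSpace X)) = P' := ext_of_generate_finite _ hgen
    (isPiSystem_piiUnionInter _ (fun t => @MeasurableSpace.isPiSystem_measurableSet _ (m t)) _)
    ?_ (by simp)
  · exact Subtype.ext hPP'
  rintro _ ⟨T, -, f, hf, rfl⟩
  have hf' : ∀ t, ∃ A : Set X, MeasurableSet A ∧
      (t ∈ T → (fun w : PathSpace X => w t) ⁻¹' A = f t) := by
    intro t
    by_cases ht : t ∈ T
    · obtain ⟨A, hA, hAf⟩ := hf t ht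
      exact ⟨A, hA, fun _ => hAf⟩
    · exact ⟨univ, MeasurableSet.univ, fun h => absurd h ht⟩
  choose A hA hAf using hf'
  have hset : (⋂ t ∈ T, f t) = {w : PathSpace X | ∀ t ∈ T, w t ∈ A t} := by
    ext w
    simp only [mem_iInter, mem_ofPred_eq]
    refine forall₂_congr fun t ht => ?_
    rw [← hAf t ht]
    rfl
  rw [hset]
  exact h T A hA

/-- If all laws in `C x` have the same one-dimensional marginals, they have the same
finite-dimensional distributions: conditioning at the earliest of the times reduces their number
by one, since the conditional laws again belong to the family. -/
theorem IsMarkovFamily.eq_of_marginals {C : X → Set (ProbabilityMeasure (PathSpace X))}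
    (hC : IsMarkovFamily C)
    (hmarg : ∀ x, ∀ P ∈ C x, ∀ P' ∈ C x, ∀ t : ℝ≥0,
      (P : Measure (PathSpace X)).map (fun w => w t) =
        (P' : Measure (PathSpace X)).map fun w => w t)
    {x : X} {P P' : ProbabilityMeasure (PathSpace X)} (hP : P ∈ C x) (hP' : P' ∈ C x) :
    P = P' := by
  classical
  obtain ⟨R, hRm, hR⟩ := hC.exists_selection_probabilityMeasure
  refine ext_of_finiteDimensional fun T A hA => ?_
  -- the offset `a` lets the times be read off from the path shifted by `a`
  have key : ∀ a : ℝ≥0, (∀ t ∈ T, a ≤ t) → ∀ x, ∀ P ∈ C x, ∀ P' ∈ C x,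
      (P : Measure (PathSpace X)) {w | ∀ t ∈ T, w (t - a) ∈ A t} =
        (P' : Measure (PathSpace X)) {w | ∀ t ∈ T, w (t - a) ∈ A t} := by
    induction T using Finset.induction_on_min with
    | empty => intro a _ x P _ P' _; simp
    | insert b T hbT ih =>
      intro a ha x P hP P' hP'
      have hab : a ≤ b := ha b (Finset.mem_insert_self b T)
      let s := b - a
      let B : Set (PathSpace X) := {w | ∀ t ∈ T, w (t - b) ∈ A t}
      have hB : MeasurableSet B := by
        have : B = ⋂ t ∈ T, (fun w : PathSpace X => w (t - b)) ⁻¹' A t := by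
          ext w; simp [B]
        rw [this]
        exact Finset.measurableSet_biInter _ fun t _ => measurable_coord _ (hA t)
      have hψ : Measurable fun y => (R y : Measure (PathSpace X)) B := by
        -- `R y` is the value at the constant path `y` of the measurable family `w ↦ R (w 0)`
        have h1 := (isMeasurableFamily_comp_coord hRm 0).measurable_apply.mono
          ((pathFiltration X).le 0) le_rfl
        have h2 : Measurable fun y : X => (ContinuousMap.const ℝ≥0 y : PathSpace X) :=
          ContinuousMap.continuous_const'.measurable
        exact (Measure.measurable_coe hB).comp (h1.comp h2)
      have hset : {w : PathSpace X | ∀ t ∈ insert b T, w (t - a) ∈ A t} =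
          (fun w : PathSpace X => w s) ⁻¹' A b ∩ shift s ⁻¹' B := by
        ext w
        simp only [Finset.mem_insert, forall_eq_or_imp, mem_ofPred_eq, mem_inter_iff, mem_preimage,
          B, shift_apply]
        refine and_congr Iff.rfl (forall₂_congr fun t ht => ?_)
        rw [show s + (t - b) = t - a by
          rw [add_comm]; exact tsub_add_tsub_cancel (hbT t ht).le hab]
      have hAs : MeasurableSet[pathFiltration X s] ((fun w : PathSpace X => w s) ⁻¹' A b) :=
        measurable_coord_of_le le_rfl (hA b)
      have e : ∀ S ∈ C x, (S : Measure (PathSpace X)) {w | ∀ t ∈ insert b T, w (t - a) ∈ A t} =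
          ∫⁻ y in A b, (R y : Measure (PathSpace X)) B
            ∂((S : Measure (PathSpace X)).map fun w => w s) := by
        intro S hS
        rw [hset, (isConcat_iff (isMeasurableFamily_condLawShift S s) S).1
          (isConcat_condLawShift S s) _ B hAs hB, setLIntegral_map (hA b) hψ (measurable_coord s)]
        obtain ⟨N, -, hSN, hNC⟩ := hC.condLaw x S hS s
        refine lintegral_congr_ae (ae_restrict_of_ae ?_)
        filter_upwards [measure_eq_zero_iff_ae_notMem.1 hSN] with w hw
        exact ih b (fun t ht => (hbT t ht).le) (w s) _ (hNC w hw) _ (hR (w s))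
      rw [e P hP, e P' hP', hmarg x P hP P' hP']
  simpa using key 0 (fun t _ => zero_le) x P hP P' hP'

end MarkovFamily

end MarkovSelection

theorem mainTheorem3 {X : Type*} [TopologicalSpace X] [PolishSpace X] [MeasurableSpace X]
    [BorelSpace X]
    (C : X → Set (ProbabilityMeasure (MarkovSelection.PathSpace X)))
    (hC1_nonempty : ∀ x, (C x).Nonempty)
    (hC1_compact : ∀ x, IsCompact (C x))
    (hC1_convex : ∀ x, Convex ℝ≥0 (ProbabilityMeasure.toFiniteMeasure '' C x))
    (hC2 : ∀ K : Set (ProbabilityMeasure (MarkovSelection.PathSpace X)), IsClosed K →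
      MeasurableSet {x | (C x ∩ K).Nonempty})
    (hC3 : ∀ x, ∀ P ∈ C x,
      (P : Measure (MarkovSelection.PathSpace X)) (MarkovSelection.pathsFrom x) = 1)
    (hMP1 : ∀ x, ∀ P ∈ C x, ∀ s : ℝ≥0,
      MarkovSelection.AlmostSurelyIn P s fun w => MarkovSelection.condLawShift P s w ∈ C (w s))
    (hMP2 : ∀ (s : ℝ≥0)
      (Q : MarkovSelection.PathSpace X → ProbabilityMeasure (MarkovSelection.PathSpace X))
      (hQ : MarkovSelection.IsMeasurableFamily s Q) (hsel : ∀ w, Q w ∈ C (w s)),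
      ∀ x, ∀ P ∈ C x,
        MarkovSelection.concat P s Q hQ (fun w => hC3 (w s) (Q w) (hsel w)) ∈ C x) :
    ∃ P : X → ProbabilityMeasure (MarkovSelection.PathSpace X),
      Measurable[‹MeasurableSpace X›, borel (ProbabilityMeasure (MarkovSelection.PathSpace X))] P ∧
      (∀ x, P x ∈ C x) ∧
      ∀ x, ∀ s : ℝ≥0,
        MarkovSelection.AlmostSurelyIn (P x) s fun w =>
          MarkovSelection.condLawShift (P x) s w = P (w s) := by
  have hC : MarkovSelection.IsMarkovFamily C := by
    refine ⟨⟨hC1_nonempty, hC1_compact, hC2⟩, hC3, hMP1, fun s Q hQ hsel x P hP R hR => ?_⟩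
    have hsupp := fun w => hC3 (w s) (Q w) (hsel w)
    rw [(MarkovSelection.existsUnique_isConcat P s Q hQ hsupp).unique hR
      (MarkovSelection.isConcat_concat P s Q hQ hsupp)]
    exact hMP2 s Q hQ hsel x P hP
  obtain ⟨G, hG, hGdet⟩ := MarkovSelection.exists_isDiscounted_determining X
  have hD := hC.iInter_iterArgmax hG
  have huniq := fun x P hP P' hP' => hD.eq_of_marginals (x := x) (P := P) (P' := P')
    (fun y S hS S' hS' => hGdet S S' (MarkovSelection.eq_of_mem_iInter_iterArgmax hS hS')) hP hP'
  choose P hP using hD.nonempty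
  refine ⟨P, hD.measurable_of_eq hP fun x S hS => huniq x S hS (P x) (hP x),
    fun x => mem_iInter.1 (hP x) 0, fun x s => ?_⟩
  obtain ⟨N, hN, hPN, hND⟩ := hD.condLaw x (P x) (hP x) s
  exact ⟨N, hN, hPN, fun w hw => huniq (w s) _ (hND w hw) _ (hP (w s))⟩
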